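/- Let $p$ be a prime. Write $[a,b]=a^{-1}b^{-1}ab$ and $a^g=g^{-1}ag$ (so $y^{jt^i}=t^{-i}y^jt^i$), and let $$G=\langle x,y,t \mid x^t=x^p,\ y^{t^{-1}}=y^p,\ [x,y]=1,\ [[x,y^{jt^i}],x]=1 \text{ for all } i,j\in\mathbb Z\rangle.$$ For a word $w(x_1,\dots,x_n)$, $n\ge 1$, put $w^{(0)}=w$ and $w^{(j+1)}(x_1,\dots,x_n)=w(w^{(j)}(x_1,\dots,x_n),x_2,\dots,x_n)$. The word $w$ is an iterated identity of a group $\Gamma$ if for all $x_1,\dots,x_n\in\Gamma$ there is $j\ge 0$ with $w^{(j)}(x_1,\dots,x_n)=1$; an iterated identity is bounded if one $j$ works for all $x_1,\dots,x_n\in\Gamma$, and unbounded otherwise. The group $\Gamma$ is bounded if every iterated identity of $\Gamma$ is bounded, and fractal if it satisfies some iterated identity and is not bounded. Then $G$ is a finitely generated solvable group of derived length exactly three, and the word $w(x_1,x_2,x_3)=[x_1,[x_2,x_3]]^p$ is an unbounded iterated identity of $G$; in particular $G$ is fractal. More precisely, for $i\ge 1$ and $x_1=x^{t^{-i}}$,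 $x_2=t^{-1}$, $x_3=(y^{-1})^{t^i}$ one has $w^{(j)}(x_1,x_2,x_3)\ne 1$ for all $j\ge 0$ with $j+1<i$. -/

import Mathlib

namespace IterId

/-- The commutator `[a, b] = a⁻¹ b⁻¹ a b`. -/
def comm {G : Type*} [Group G] (a b : G) : G := a⁻¹ * b⁻¹ * a * b

/-- The conjugate `a ^ g = g⁻¹ a g`. -/
def cj {G : Type*} [Group G] (a g : G) : G := g⁻¹ * a * g

/-- The iterations `w^(j)` of a word on the `n + 1` letters `x 0, …, x n`:
`w^(0)(x) = w(x)`, and `w^(j+1)(x)` is `w` evaluated after replacing the first letter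
by `w^(j)(x)`. -/
def iter {G : Type*} [Group G] {n : ℕ} (w : FreeGroup (Fin (n + 1)))
    (x : Fin (n + 1) → G) : ℕ → G
  | 0 => FreeGroup.lift x w
  | j + 1 => FreeGroup.lift (Function.update x 0 (iter w x j)) w

/-- `w` is an iterated identity of `G`. -/
def IsIteratedIdentity (G : Type*) [Group G] {n : ℕ} (w : FreeGroup (Fin (n + 1))) : Prop :=
  ∀ x : Fin (n + 1) → G, ∃ j : ℕ, iter w x j = 1

/-- Some iteration of `w` is trivial on all of `G` at once. -/
def IsBoundedOn (G : Type*) [Group G] {n : ℕ} (w : FreeGroup (Fin (n + 1))) : Prop :=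
  ∃ j : ℕ, ∀ x : Fin (n + 1) → G, iter w x j = 1

/-- A group is bounded if each of its iterated identities is bounded. -/
def IsBoundedGroup (G : Type*) [Group G] : Prop :=
  ∀ (n : ℕ) (w : FreeGroup (Fin (n + 1))), IsIteratedIdentity G w → IsBoundedOn G w

/-- A group is fractal if it satisfies some iterated identity and is not bounded. -/
def IsFractalGroup (G : Type*) [Group G] : Prop :=
  (∃ (n : ℕ) (w : FreeGroup (Fin (n + 1))), IsIteratedIdentity G w) ∧ ¬ IsBoundedGroup G

/-- `G` is solvable of derived length exactly `n`. -/
def HasDerivedLength (G : Type*) [Group G] (n : ℕ) : Prop :=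
  derivedSeries G n = ⊥ ∧ ∀ m < n, derivedSeries G m ≠ ⊥

/-- The names of the three generators. -/
inductive Gen
  | x
  | y
  | t

/-- The free generators. -/
abbrev fx : FreeGroup Gen := FreeGroup.of Gen.x
/-- The free generators. -/
abbrev fy : FreeGroup Gen := FreeGroup.of Gen.y
/-- The free generators. -/
abbrev ft : FreeGroup Gen := FreeGroup.of Gen.t

/-- The relators of
`⟨x, y, t | x^t = x^p, y^(t⁻¹) = y^p, [x,y] = 1, [[x, (y^j)^(t^i)], x] = 1 (i, j ∈ ℤ)⟩`. -/
def rels (p : ℕ) : Set (FreeGroup Gen) :=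
  {cj fx ft * (fx ^ p)⁻¹, cj fy ft⁻¹ * (fy ^ p)⁻¹, comm fx fy} ∪
    {r | ∃ i j : ℤ, r = comm (comm fx (cj (fy ^ j) (ft ^ i))) fx}

/-- The group `G`. -/
abbrev G (p : ℕ) : Type := PresentedGroup (rels p)

/-- The image of a generator in `G`. -/
def gen (p : ℕ) (s : Gen) : G p := PresentedGroup.of s

/-- The word `w(x₁, x₂, x₃) = [x₁, [x₂, x₃]]^p`. -/
def w (p : ℕ) : FreeGroup (Fin 3) :=
  comm (FreeGroup.of 0) (comm (FreeGroup.of 1) (FreeGroup.of 2)) ^ p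

/-- The triple `x₁ = x^(t^(-i))`, `x₂ = t⁻¹`, `x₃ = (y⁻¹)^(t^i)`. -/
def triple (p i : ℕ) : Fin 3 → G p :=
  ![cj (gen p .x) (gen p .t ^ (-(i : ℤ))), (gen p .t)⁻¹, cj (gen p .y)⁻¹ (gen p .t ^ (i : ℤ))]

end IterId

namespace IterId

open scoped commutatorElement

/-! ### Conjugation, commutators and iterates under homomorphisms. -/

section Words

variable {H K : Type*} [Group H] [Group K]

/-! Write x_k, y_k for the conjugates of x, y by t^k. Then x_{k+1} = x_k^p and y_{k-1} = y_k^p, so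
the y_k generate an abelian group Y, an increasing union of cyclic groups. The last family of
relators says that x commutes with all its Y-conjugates, so the Y-conjugates of the x_k generate an
abelian normal subgroup X. As G' ≤ YX and G'' ≤ X, the third derived subgroup is trivial.

From j = 1 on, the iterates of w lie in X, and g = [x₂, x₃] lies in YX. Since x_k commutes with y_l
for l ≤ k, some power a^(p^m) of any a in X commutes with g (`exists_commute_pow`). On X one has [a,
g]^p = [a^p, g], so each iteration uses up one factor p and the iterates die (`exists_iter_eq_one`);
m depends on the arguments.

For lower bounds, G acts on ℤ × ℚ × ℚ/ℤ: x shifts the fibre by a function, y translates ℚ, and t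
shifts ℤ and dilates ℚ by p. Iterating w then becomes a p-scaled finite difference, and one
well-chosen point of the base shows a nonzero value (`scaledDiff_eval`, `iter_triple_ne_one`). The
same action detects G'' ≠ 1. -/

theorem map_comm (f : H →* K) (a b : H) : f (comm a b) = comm (f a) (f b) := by
  simp [comm]

theorem map_cj (f : H →* K) (a b : H) : f (cj a b) = cj (f a) (f b) := by
  simp [cj]

theorem cj_cj (a b c : H) : cj (cj a b) c = cj a (b * c) := by
  simp [cj, mul_assoc]

theorem cj_mul (a b c : H) : cj (a * b) c = cj a c * cj b c := by
  simp [cj, mul_assoc]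

theorem cj_inv (a c : H) : cj a⁻¹ c = (cj a c)⁻¹ := by
  simp [cj, mul_assoc]

theorem cj_one (a : H) : cj a 1 = a := by
  simp [cj]

theorem cj_inj {a b : H} (c : H) : cj a c = cj b c ↔ a = b := by
  simp [cj]

theorem comm_eq_one_iff {a b : H} : comm a b = 1 ↔ Commute a b := by
  have : comm a b = (b * a)⁻¹ * (a * b) := by simp [comm, mul_assoc]
  rw [this, inv_mul_eq_one]
  exact eq_comm

theorem lift_w (p : ℕ) (x : Fin 3 → H) :
    FreeGroup.lift x (w p) = comm (x 0) (comm (x 1) (x 2)) ^ p := by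
  simp [w, map_comm]

theorem iter_w_zero (p : ℕ) (x : Fin 3 → H) :
    iter (w p) x 0 = comm (x 0) (comm (x 1) (x 2)) ^ p := lift_w p x

theorem iter_w_succ (p : ℕ) (x : Fin 3 → H) (j : ℕ) :
    iter (w p) x (j + 1) = comm (iter (w p) x j) (comm (x 1) (x 2)) ^ p := by
  have h := lift_w p (Function.update x 0 (iter (w p) x j))
  simp only [Function.update_self, ne_eq, Fin.isValue, one_ne_zero, not_false_eq_true,
    Function.update_of_ne, Fin.reduceEq] at h
  exact h

theorem map_iter (f : H →* K) {n : ℕ} (v : FreeGroup (Fin (n + 1))) (x : Fin (n + 1) → H)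
    (j : ℕ) : f (iter v x j) = iter v (f ∘ x) j := by
  have key (z : Fin (n + 1) → H) : f (FreeGroup.lift z v) = FreeGroup.lift (f ∘ z) v := by
    have : f.comp (FreeGroup.lift z) = FreeGroup.lift (f ∘ z) := by ext; simp
    exact DFunLike.congr_fun this v
  induction j with
  | zero => exact key x
  | succ j ih => simp only [iter, key, ← ih, Function.comp_update]

theorem cj_pow (a g : H) (n : ℕ) : cj (a ^ n) g = cj a g ^ n := by
  simpa [cj] using (conj_pow (a := g⁻¹) (b := a) (i := n)).symm

theorem cj_zpow (a g : H) (n : ℤ) : cj (a ^ n) g = cj a g ^ n := by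
  simpa [cj] using (conj_zpow (a := g⁻¹) (b := a) (i := n)).symm

theorem cj_eq_of_commute {a g : H} (h : Commute a g) : cj a g = a := by
  rw [cj, mul_assoc, h.eq, inv_mul_cancel_left]

theorem commute_cj {a b : H} (h : Commute a b) (g : H) : Commute (cj a g) (cj b g) := by
  rw [Commute, SemiconjBy, ← cj_mul, ← cj_mul, h.eq]

theorem comm_eq_inv_mul_cj (a g : H) : comm a g = a⁻¹ * cj a g := by
  simp [comm, cj, mul_assoc]

theorem comm_eq_commutatorElement (a b : H) : comm a b = ⁅a⁻¹, b⁻¹⁆ := by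
  simp [comm, commutatorElement_def]

theorem comm_pow_left {a g : H} (h : Commute a (cj a g)) (n : ℕ) :
    comm a g ^ n = comm (a ^ n) g := by
  rw [comm_eq_inv_mul_cj, comm_eq_inv_mul_cj, cj_pow, h.inv_left.mul_pow, inv_pow]

theorem cj_mem_of_mem_closure {S : Set H} {K : Subgroup H} {g : H}
    (h : ∀ a ∈ S, cj a g ∈ K) {a : H} (ha : a ∈ Subgroup.closure S) : cj a g ∈ K := by
  induction ha using Subgroup.closure_induction with
  | mem a ha => exact h a ha
  | one => simp [cj]
  | mul a b _ _ h1 h2 => rw [cj_mul]; exact K.mul_mem h1 h2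
  | inv a _ h1 => rw [cj_inv]; exact K.inv_mem h1

theorem commute_of_mem_closure {S : Set H} (h : ∀ a ∈ S, ∀ b ∈ S, Commute a b) {a b : H}
    (ha : a ∈ Subgroup.closure S) (hb : b ∈ Subgroup.closure S) : Commute a b := by
  induction ha, hb using Subgroup.closure_induction₂ with
  | mem a b ha hb => exact h a ha b hb
  | one_left => exact Commute.one_left _
  | one_right => exact Commute.one_right _
  | mul_left a b c _ _ _ h1 h2 => exact h1.mul_left h2
  | mul_right a b c _ _ _ h1 h2 => exact h1.mul_right h2
  | inv_left a b _ _ h1 => exact h1.inv_left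
  | inv_right a b _ _ h1 => exact h1.inv_right

end Words

/-! ### A permutation representation of the group. -/

section Model

/-- The set on which a quotient of `G p` acts. -/
abbrev ModelSpace : Type := ℤ × ℚ × AddCircle (1 : ℚ)

/-- Translation of the third coordinate by a function of the first two. -/
def fiberShift (φ : ℤ → ℚ → AddCircle (1 : ℚ)) : Equiv.Perm ModelSpace where
  toFun a := (a.1, a.2.1, a.2.2 + φ a.1 a.2.1)
  invFun a := (a.1, a.2.1, a.2.2 - φ a.1 a.2.1)
  left_inv a := by simp
  right_inv a := by simp

/-- Translation of the second coordinate. -/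
def baseShift (c : ℚ) : Equiv.Perm ModelSpace where
  toFun a := (a.1, a.2.1 + c, a.2.2)
  invFun a := (a.1, a.2.1 - c, a.2.2)
  left_inv a := by simp
  right_inv a := by simp

/-- Translation of the first coordinate together with dilation of the second. -/
def dilation (u : ℚˣ) : Equiv.Perm ModelSpace where
  toFun a := (a.1 + 1, u * a.2.1, a.2.2)
  invFun a := (a.1 - 1, (u⁻¹ : ℚˣ) * a.2.1, a.2.2)
  left_inv a := by simp
  right_inv a := by simp

theorem fiberShift_mul (φ ψ : ℤ → ℚ → AddCircle (1 : ℚ)) :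
    fiberShift φ * fiberShift ψ = fiberShift (φ + ψ) := by
  ext1 a; simp [fiberShift, add_assoc, add_comm (φ _ _)]

theorem fiberShift_inv (φ : ℤ → ℚ → AddCircle (1 : ℚ)) :
    (fiberShift φ)⁻¹ = fiberShift (-φ) := by
  rw [inv_eq_iff_mul_eq_one, fiberShift_mul]
  ext1 a; simp [fiberShift]

theorem fiberShift_pow (φ : ℤ → ℚ → AddCircle (1 : ℚ)) (n : ℕ) :
    fiberShift φ ^ n = fiberShift (n • φ) := by
  induction n with
  | zero => ext1 a; simp [fiberShift]
  | succ n ih => rw [pow_succ, ih, fiberShift_mul, succ_nsmul]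

theorem eq_zero_of_fiberShift_eq_one {φ : ℤ → ℚ → AddCircle (1 : ℚ)} (h : fiberShift φ = 1)
    (s : ℤ) (z : ℚ) : φ s z = 0 := by
  simpa [fiberShift] using DFunLike.congr_fun h (s, z, 0)

theorem baseShift_mul (c d : ℚ) : baseShift c * baseShift d = baseShift (c + d) := by
  ext1 a; simp [baseShift, add_assoc, add_comm c]

theorem baseShift_zero : baseShift 0 = 1 := by
  ext1 a; simp [baseShift]

theorem baseShift_inv (c : ℚ) : (baseShift c)⁻¹ = baseShift (-c) := by
  rw [inv_eq_iff_mul_eq_one, baseShift_mul, add_neg_cancel, baseShift_zero]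

theorem baseShift_pow (c : ℚ) (n : ℕ) : baseShift c ^ n = baseShift (n * c) := by
  induction n with
  | zero => simp [baseShift_zero]
  | succ n ih => rw [pow_succ, ih, baseShift_mul]; congr 1; push_cast; ring

theorem baseShift_zpow (c : ℚ) (n : ℤ) : baseShift c ^ n = baseShift (n * c) := by
  obtain ⟨m, rfl | rfl⟩ := n.eq_nat_or_neg
  · simp [baseShift_pow]
  · simp [baseShift_pow, baseShift_inv]

theorem comm_fiberShift_baseShift (φ : ℤ → ℚ → AddCircle (1 : ℚ)) (c : ℚ) :
    comm (fiberShift φ) (baseShift c) = fiberShift fun s z => φ s (z + c) - φ s z := by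
  rw [comm, fiberShift_inv, baseShift_inv]
  ext1 a; simp [fiberShift, baseShift]; abel

theorem commute_fiberShift (φ ψ : ℤ → ℚ → AddCircle (1 : ℚ)) :
    Commute (fiberShift φ) (fiberShift ψ) := by
  rw [Commute, SemiconjBy, fiberShift_mul, fiberShift_mul, add_comm]

theorem cj_baseShift_dilation (u : ℚˣ) (c : ℚ) :
    cj (baseShift c) (dilation u) = baseShift ((u⁻¹ : ℚˣ) * c) := by
  rw [cj, mul_assoc, inv_mul_eq_iff_eq_mul]
  ext1 a; simp [dilation, baseShift, mul_add]

theorem cj_fiberShift_dilation (u : ℚˣ) (φ : ℤ → ℚ → AddCircle (1 : ℚ)) :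
    cj (fiberShift φ) (dilation u) = fiberShift fun s z => φ (s + 1) (u * z) := by
  rw [cj, mul_assoc, inv_mul_eq_iff_eq_mul]
  ext1 a; simp [dilation, fiberShift]

theorem cj_baseShift_dilation_zpow (u : ℚˣ) (c : ℚ) (k : ℤ) :
    cj (baseShift c) (dilation u ^ k) = baseShift ((u ^ (-k) : ℚˣ) * c) := by
  induction k with
  | zero => simp [cj_one]
  | succ k ih =>
    rw [zpow_add_one, ← cj_cj, ih, cj_baseShift_dilation, ← mul_assoc, ← Units.val_mul]
    congr 3; group
  | pred k ih =>
    rw [← cj_inj (dilation u), cj_cj, ← zpow_add_one, sub_add_cancel, ih, cj_baseShift_dilation,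
      ← mul_assoc, ← Units.val_mul]
    congr 3; group

variable (p : ℕ)

open Classical in
/-- The function equal to `r * p ^ s` on `p ^ s * ℤ` and to `0` off it, modulo `1`. -/
noncomputable def bump (r : ℚ) (s : ℤ) (z : ℚ) : AddCircle (1 : ℚ) :=
  if ∃ m : ℤ, z = m * (p : ℚ) ^ s then ((r * (p : ℚ) ^ s : ℚ) : AddCircle (1 : ℚ)) else 0

variable {p}

theorem bump_congr {r r' z z' : ℚ} {s s' : ℤ}
    (h : (∃ m : ℤ, z = m * (p : ℚ) ^ s) ↔ ∃ m : ℤ, z' = m * (p : ℚ) ^ s')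
    (hr : r * (p : ℚ) ^ s = r' * (p : ℚ) ^ s') : bump p r s z = bump p r' s' z' := by
  rw [bump, bump, hr]
  by_cases hz : ∃ m : ℤ, z = m * (p : ℚ) ^ s
  · rw [if_pos hz, if_pos (h.1 hz)]
  · rw [if_neg hz, if_neg (mt h.2 hz)]

theorem bump_zero (r : ℚ) (s : ℤ) : bump p r s 0 = ((r * (p : ℚ) ^ s : ℚ) : AddCircle (1 : ℚ)) :=
  if_pos ⟨0, by simp⟩

theorem nsmul_bump (n : ℕ) (r : ℚ) : n • bump p r = bump p (n * r) := by
  funext s z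
  simp only [Pi.smul_apply, bump]
  split_ifs
  · rw [← AddCircle.coe_nsmul, nsmul_eq_mul, mul_assoc]
  · simp

/-- This encodes x^t = x^p: dilation carries p^s ℤ onto p^(s+1) ℤ, and the value gains a factor p.
-/
theorem bump_dilate (hp : p ≠ 0) (r : ℚ) (s : ℤ) (z : ℚ) :
    bump p r (s + 1) (p * z) = bump p (p * r) s z := by
  have hp' : (p : ℚ) ≠ 0 := by exact_mod_cast hp
  have h : (∃ m : ℤ, p * z = m * (p : ℚ) ^ (s + 1)) ↔ ∃ m : ℤ, z = m * (p : ℚ) ^ s := by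
    refine exists_congr fun m => ?_
    rw [zpow_add_one₀ hp', ← mul_assoc, mul_comm _ (p : ℚ), mul_right_inj' hp']
  refine bump_congr h ?_
  rw [zpow_add_one₀ hp']; ring

/-- This encodes [x, y] = 1. For s ≥ 0 the value p^s is an integer, so zero modulo 1; for s ≤ 0 the
support p^s ℤ contains ℤ, hence is invariant under translation by 1. -/
theorem bump_one_add_one (hp : p ≠ 0) (s : ℤ) (z : ℚ) : bump p 1 s (z + 1) = bump p 1 s z := by
  have hp' : (p : ℚ) ≠ 0 := by exact_mod_cast hp
  obtain ⟨n, rfl | rfl⟩ := s.eq_nat_or_neg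
  · have h : ((1 * (p : ℚ) ^ (n : ℤ) : ℚ) : AddCircle (1 : ℚ)) = 0 :=
      (AddCircle.coe_eq_zero_iff _).2 ⟨p ^ n, by simp⟩
    rw [bump, bump, h, ite_self, ite_self]
  · have h1 : (p : ℚ) ^ n * (p : ℚ) ^ (-(n : ℤ)) = 1 := by
      rw [zpow_neg, zpow_natCast, mul_inv_cancel₀ (pow_ne_zero _ hp')]
    have h : (∃ m : ℤ, z + 1 = m * (p : ℚ) ^ (-(n : ℤ))) ↔
        ∃ m : ℤ, z = m * (p : ℚ) ^ (-(n : ℤ)) := by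
      constructor
      · rintro ⟨m, hm⟩
        exact ⟨m - p ^ n, by push_cast; linear_combination hm + h1⟩
      · rintro ⟨m, hm⟩
        exact ⟨m + p ^ n, by push_cast; linear_combination hm - h1⟩
    exact bump_congr h rfl

theorem cj_bump_dilation (u : ℚˣ) (hu : (u : ℚ) = p) (r : ℚ) :
    cj (fiberShift (bump p r)) (dilation u) = fiberShift (bump p (u * r)) := by
  have hp : p ≠ 0 := by rintro rfl; exact u.ne_zero (by simp [hu])
  rw [cj_fiberShift_dilation]
  congr 1; funext s z
  rw [hu, bump_dilate hp]

theorem cj_bump_dilation_zpow (u : ℚˣ) (hu : (u : ℚ) = p) (r : ℚ) (k : ℤ) :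
    cj (fiberShift (bump p r)) (dilation u ^ k) = fiberShift (bump p ((u ^ k : ℚˣ) * r)) := by
  induction k with
  | zero => simp [cj_one]
  | succ k ih =>
    rw [zpow_add_one, ← cj_cj, ih, cj_bump_dilation u hu, ← mul_assoc, ← Units.val_mul]
    congr 4; group
  | pred k ih =>
    rw [← cj_inj (dilation u), cj_cj, ← zpow_add_one, sub_add_cancel, ih, cj_bump_dilation u hu,
      ← mul_assoc, ← Units.val_mul]
    congr 4; group

/-- The images of the generators of `G p` in the model. -/
noncomputable def modelGen (p : ℕ) (u : ℚˣ) : Gen → Equiv.Perm ModelSpace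
  | .x => fiberShift (bump p 1)
  | .y => baseShift 1
  | .t => dilation u

theorem modelGen_rels (u : ℚˣ) (hu : (u : ℚ) = p) :
    ∀ r ∈ rels p, FreeGroup.lift (modelGen p u) r = 1 := by
  have hp : p ≠ 0 := by rintro rfl; exact u.ne_zero (by simp [hu])
  rintro r ((rfl | rfl | rfl) | ⟨i, j, rfl⟩)
  · simp only [map_mul, map_inv, map_pow, map_cj, FreeGroup.lift_apply_of, modelGen,
      cj_bump_dilation u hu, fiberShift_pow, nsmul_bump, hu, mul_inv_cancel]
  · have := cj_baseShift_dilation_zpow u 1 (-1)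
    simp only [zpow_neg_one, neg_neg, zpow_one, hu] at this
    simp only [map_mul, map_inv, map_pow, map_cj, FreeGroup.lift_apply_of, modelGen,
      this, baseShift_pow, mul_inv_cancel]
  · simp only [map_comm, FreeGroup.lift_apply_of, modelGen, comm_fiberShift_baseShift,
      bump_one_add_one hp, sub_self]
    ext1 a; simp [fiberShift]
  · simp only [map_comm, map_cj, map_zpow, FreeGroup.lift_apply_of, modelGen, baseShift_zpow,
      cj_baseShift_dilation_zpow, comm_fiberShift_baseShift]
    exact comm_eq_one_iff.2 (commute_fiberShift _ _)

/-- The action of `G p` on the model space. -/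
noncomputable def toModel (u : ℚˣ) (hu : (u : ℚ) = p) : G p →* Equiv.Perm ModelSpace :=
  PresentedGroup.toGroup (modelGen_rels u hu)

theorem toModel_gen (u : ℚˣ) (hu : (u : ℚ) = p) (s : Gen) :
    toModel u hu (gen p s) = modelGen p u s :=
  PresentedGroup.toGroup.of _

/-! ### Iterates of `w` as finite differences. -/

theorem comm_dilation_baseShift (u : ℚˣ) (c : ℚ) :
    comm (dilation u)⁻¹ (baseShift (-c)) = baseShift ((u - 1) * c) := by
  have h := cj_baseShift_dilation_zpow u c (-1)
  simp only [cj, zpow_neg_one, inv_inv, neg_neg, zpow_one] at h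
  rw [comm, inv_inv, baseShift_inv, neg_neg, h, baseShift_mul]
  congr 1; ring

/-- The iterated scaled differences of a function along a step. -/
def scaledDiff (p : ℕ) (c : ℚ) (φ : ℤ → ℚ → AddCircle (1 : ℚ)) : ℕ → ℤ → ℚ → AddCircle (1 : ℚ)
  | 0 => φ
  | n + 1 => p • fun s z => scaledDiff p c φ n s (z + c) - scaledDiff p c φ n s z

theorem iter_w_model {v : Fin 3 → Equiv.Perm ModelSpace} {c : ℚ}
    {φ : ℤ → ℚ → AddCircle (1 : ℚ)} (h0 : v 0 = fiberShift φ)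
    (h : comm (v 1) (v 2) = baseShift c) (j : ℕ) :
    iter (w p) v j = fiberShift (scaledDiff p c φ (j + 1)) := by
  induction j with
  | zero =>
    rw [iter_w_zero, h0, h, comm_fiberShift_baseShift, fiberShift_pow]; rfl
  | succ j ih =>
    rw [iter_w_succ, ih, h, comm_fiberShift_baseShift, fiberShift_pow, scaledDiff.eq_2 p c φ (j + 1)]

/-- Each difference moves the value at 0 one step further left, scaled by p, because the other term
is still zero: points beyond the front have not yet been reached. -/
theorem scaledDiff_eval {c : ℚ} {φ : ℤ → ℚ → AddCircle (1 : ℚ)} {s : ℤ} {n : ℕ}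
    (h : ∀ l : ℕ, 0 < l → l ≤ n → φ s (-(l * c)) = 0) (m : ℕ) (hm : m ≤ n) :
    scaledDiff p c φ m s (-(m * c)) = p ^ m • φ s 0 ∧
      ∀ l : ℕ, m < l → l ≤ n → scaledDiff p c φ m s (-(l * c)) = 0 := by
  induction m with
  | zero => exact ⟨by simp [scaledDiff], fun l h1 h2 => h l h1 h2⟩
  | succ m ih =>
    obtain ⟨ih1, ih2⟩ := ih (by omega)
    have e (l : ℕ) : -(((l + 1 : ℕ) : ℚ) * c) + c = -(l * c) := by push_cast; ring
    constructor
    · simp only [scaledDiff, Pi.smul_apply, e, ih1, ih2 (m + 1) (by omega) hm, sub_zero]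
      rw [← mul_nsmul, pow_succ]
    · rintro (_ | l) h1 h2
      · omega
      · simp only [scaledDiff, Pi.smul_apply, e, ih2 l (by omega) (by omega),
          ih2 (l + 1) (by omega) h2, sub_zero, smul_zero]

/-- Lying in the support would force p^n ∣ l (p - 1), hence p^n ∣ l by coprimality, against 0 < l ≤
n < p^n. -/
theorem bump_eq_zero_of_step (hp : 1 < p) (r : ℚ) (i n l : ℕ) (hl : 0 < l) (hln : l ≤ n) :
    bump p r ((n : ℤ) - i) (-(l * ((p - 1) * (p : ℚ) ^ (-(i : ℤ))))) = 0 := by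
  have hp' : (p : ℚ) ≠ 0 := by exact_mod_cast (by omega : p ≠ 0)
  refine if_neg ?_
  rintro ⟨m, hm⟩
  have h1 : -((l : ℚ) * (p - 1)) = m * p ^ n := by
    rw [sub_eq_add_neg (n : ℤ), zpow_add₀ hp', zpow_natCast] at hm
    have := zpow_ne_zero (-(i : ℤ)) hp'
    apply mul_right_cancel₀ this
    linear_combination hm
  have h2 : -((l : ℤ) * (p - 1)) = m * p ^ n := by exact_mod_cast h1
  have h3 : (p : ℤ) ^ n ∣ l * (p - 1) := (dvd_neg).1 ⟨m, by rw [h2, mul_comm]⟩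
  have hc : IsCoprime ((p : ℤ) ^ n) (p - 1) := IsCoprime.pow_left ⟨1, -1, by ring⟩
  have h4 : p ^ n ∣ l := by exact_mod_cast hc.dvd_of_dvd_mul_right h3
  exact absurd (Nat.le_of_dvd hl h4) (by have := Nat.lt_pow_self (n := n) hp; omega)

theorem coe_zpow_neg_ne_zero (hp : 1 < p) {k : ℤ} (hk : k < 0) :
    (((p : ℚ) ^ k : ℚ) : AddCircle (1 : ℚ)) ≠ 0 := by
  rw [Ne, AddCircle.coe_eq_zero_iff]
  rintro ⟨m, hm⟩
  have hp' : (1 : ℚ) < p := by exact_mod_cast hp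
  have h0 : (0 : ℚ) < (p : ℚ) ^ k := zpow_pos (by linarith) _
  have h1 : (p : ℚ) ^ k < 1 := zpow_lt_one_of_neg₀ hp' hk
  simp only [zsmul_eq_mul, mul_one] at hm
  rw [← hm] at h0 h1
  have h0' : (0 : ℤ) < m := by exact_mod_cast h0
  have h1' : m < 1 := by exact_mod_cast h1
  omega

theorem iter_triple_ne_one (hp : 1 < p) {i j : ℕ} (hij : j + 1 < i) :
    iter (w p) (triple p i) j ≠ 1 := by
  have hp' : (p : ℚ) ≠ 0 := by exact_mod_cast (by omega : p ≠ 0)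
  set u : ℚˣ := Units.mk0 p hp' with hu
  have hup : (u : ℚ) = p := rfl
  set c : ℚ := (p - 1) * (p : ℚ) ^ (-(i : ℤ)) with hc
  set φ := bump p ((p : ℚ) ^ (-(i : ℤ))) with hφ
  intro h
  have h' := congrArg (toModel u hup) h
  rw [map_one, map_iter] at h'
  have e0 : (toModel u hup ∘ triple p i) 0 = fiberShift φ := by
    simp only [Function.comp, triple, Matrix.cons_val_zero, map_cj, map_zpow, toModel_gen,
      modelGen, cj_bump_dilation_zpow u hup]
    simp [hφ, hu]
  have e1 : comm ((toModel u hup ∘ triple p i) 1) ((toModel u hup ∘ triple p i) 2)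
      = baseShift c := by
    simp only [Function.comp, triple, Matrix.cons_val, map_cj, map_zpow, map_inv, toModel_gen,
      modelGen, cj_inv, cj_baseShift_dilation_zpow, baseShift_inv, comm_dilation_baseShift]
    simp [hc, hu]
  rw [iter_w_model e0 e1] at h'
  -- At level s = j + 1 - i the support of φ is sparse enough to miss the points -l c for 0 < l ≤ j
  -- + 1.
  have h1 := eq_zero_of_fiberShift_eq_one h' (((j + 1 : ℕ) : ℤ) - i) (-((j + 1 : ℕ) * c))
  rw [(scaledDiff_eval (fun l => bump_eq_zero_of_step hp _ i (j + 1) l) (j + 1) le_rfl).1,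
    bump_zero, ← AddCircle.coe_nsmul, nsmul_eq_mul] at h1
  -- The exponent collects j + 1 from the scaling, -i from the height of φ, and j + 1 - i from the
  -- level s.
  refine coe_zpow_neg_ne_zero hp (k := 2 * ((j + 1 : ℕ) - i : ℤ)) (by omega) (Eq.trans ?_ h1)
  congr 1
  push_cast
  rw [← zpow_natCast, ← zpow_add₀ hp', ← zpow_add₀ hp']
  congr 1; push_cast; ring

end Model

/-! ### The abelian subgroups generated by conjugates of y and of x. -/

section Structure

variable {p : ℕ}

theorem closure_range_gen (p : ℕ) : Subgroup.closure (Set.range (gen p)) = ⊤ :=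
  PresentedGroup.closure_range_of _

theorem normal_of_cj_gen_mem {K : Subgroup (G p)} (h : ∀ s, ∀ a ∈ K, cj a (gen p s) ∈ K)
    (h' : ∀ s, ∀ a ∈ K, cj a (gen p s)⁻¹ ∈ K) : K.Normal := by
  have key (g : G p) : ∀ a ∈ K, cj a g ∈ K := by
    have hg : g ∈ Subgroup.closure (Set.range (gen p)) := by simp [closure_range_gen]
    induction hg using Subgroup.closure_induction'' with
    | mem g hg => obtain ⟨s, rfl⟩ := hg; exact h s
    | inv_mem g hg => obtain ⟨s, rfl⟩ := hg; exact h' s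
    | one => intro a ha; rwa [cj_one]
    | mul g k _ _ h1 h2 => intro a ha; rw [← cj_cj]; exact h2 _ (h1 _ ha)
  refine ⟨fun a ha g => ?_⟩
  simpa [cj] using key g⁻¹ a ha

theorem mk_eq_one {r : FreeGroup Gen} (h : r ∈ rels p) : PresentedGroup.mk (rels p) r = 1 :=
  PresentedGroup.one_of_mem h

theorem mk_of (s : Gen) : PresentedGroup.mk (rels p) (FreeGroup.of s) = gen p s := rfl

theorem cj_gen_x : cj (gen p .x) (gen p .t) = gen p .x ^ p := by
  have h := mk_eq_one (p := p) (Or.inl (Or.inl rfl))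
  rw [map_mul, map_inv, map_pow, map_cj, mk_of, mk_of, mul_inv_eq_one] at h
  exact h

theorem cj_gen_y : cj (gen p .y) (gen p .t)⁻¹ = gen p .y ^ p := by
  have h := mk_eq_one (p := p) (Or.inl (Or.inr (Or.inl rfl)))
  rw [map_mul, map_inv, map_pow, map_cj, map_inv, mk_of, mk_of, mul_inv_eq_one] at h
  exact h

theorem commute_gen_x_gen_y : Commute (gen p .x) (gen p .y) := by
  have h := mk_eq_one (p := p) (Or.inl (Or.inr (Or.inr rfl)))
  rwa [map_comm, mk_of, mk_of, comm_eq_one_iff] at h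

theorem commute_comm_gen_x (i j : ℤ) :
    Commute (comm (gen p .x) (cj (gen p .y ^ j) (gen p .t ^ i))) (gen p .x) := by
  have h := mk_eq_one (p := p) (Or.inr ⟨i, j, rfl⟩)
  rwa [map_comm, map_comm, map_cj, map_zpow, map_zpow, mk_of, mk_of, mk_of,
    comm_eq_one_iff] at h

variable (p) in
/-- The conjugates of `x` by powers of `t`. -/
def xt (k : ℤ) : G p := cj (gen p .x) (gen p .t ^ k)

variable (p) in
/-- The conjugates of `y` by powers of `t`. -/
def yt (k : ℤ) : G p := cj (gen p .y) (gen p .t ^ k)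

theorem cj_xt (k l : ℤ) : cj (xt p k) (gen p .t ^ l) = xt p (k + l) := by
  rw [xt, cj_cj, ← zpow_add, xt]

theorem cj_yt (k l : ℤ) : cj (yt p k) (gen p .t ^ l) = yt p (k + l) := by
  rw [yt, cj_cj, ← zpow_add, yt]

theorem xt_zero : xt p 0 = gen p .x := by simp [xt, cj_one]

theorem yt_zero : yt p 0 = gen p .y := by simp [yt, cj_one]

theorem xt_add_one (k : ℤ) : xt p (k + 1) = xt p k ^ p := by
  have h := congrArg (fun a => cj a (gen p .t ^ k)) (cj_gen_x (p := p))
  simp only [cj_cj, cj_pow] at h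
  rw [xt, xt, ← h, add_comm, zpow_one_add]

theorem yt_sub_one (k : ℤ) : yt p (k - 1) = yt p k ^ p := by
  have h := congrArg (fun a => cj a (gen p .t ^ k)) (cj_gen_y (p := p))
  simp only [cj_cj, cj_pow] at h
  rw [yt, yt, ← h, ← zpow_neg_one, ← zpow_add, neg_add_eq_sub]

theorem xt_add_nat (k : ℤ) (m : ℕ) : xt p (k + m) = xt p k ^ p ^ m := by
  induction m with
  | zero => simp
  | succ m ih => rw [Nat.cast_succ, ← add_assoc, xt_add_one, ih, ← pow_mul, pow_succ]

theorem yt_sub_nat (k : ℤ) (m : ℕ) : yt p (k - m) = yt p k ^ p ^ m := by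
  induction m with
  | zero => simp
  | succ m ih => rw [Nat.cast_succ, ← sub_sub, yt_sub_one, ih, ← pow_mul, pow_succ]

theorem exists_yt_eq_pow {k l : ℤ} (h : k ≤ l) : ∃ n : ℕ, yt p k = yt p l ^ n := by
  obtain ⟨m, hm⟩ := Int.le.dest h
  exact ⟨p ^ m, by rw [← yt_sub_nat]; congr 1; omega⟩

theorem exists_xt_eq_pow {k l : ℤ} (h : l ≤ k) : ∃ n : ℕ, xt p k = xt p l ^ n := by
  obtain ⟨m, hm⟩ := Int.le.dest h
  exact ⟨p ^ m, by rw [← xt_add_nat]; congr 1; omega⟩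

theorem commute_xt_yt {k l : ℤ} (h : l ≤ k) : Commute (xt p k) (yt p l) := by
  obtain ⟨n, hn⟩ := exists_yt_eq_pow (p := p) h
  rw [hn]
  exact (commute_cj commute_gen_x_gen_y _).pow_right n

variable (p) in
/-- The subgroup generated by the conjugates of `y` by powers of `t`. -/
def ySubgroup : Subgroup (G p) := Subgroup.closure (Set.range (yt p))

theorem yt_mem (k : ℤ) : yt p k ∈ ySubgroup p := Subgroup.subset_closure ⟨k, rfl⟩

theorem exists_eq_yt_zpow {h : G p} (hh : h ∈ ySubgroup p) : ∃ k n : ℤ, h = yt p k ^ n := by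
  induction hh using Subgroup.closure_induction with
  | mem h hh => obtain ⟨k, rfl⟩ := hh; exact ⟨k, 1, by simp⟩
  | one => exact ⟨0, 0, by simp⟩
  | mul a b _ _ ha hb =>
    obtain ⟨k, n, rfl⟩ := ha
    obtain ⟨l, m, rfl⟩ := hb
    obtain ⟨r, hr⟩ := exists_yt_eq_pow (p := p) (le_max_left k l)
    obtain ⟨s, hs⟩ := exists_yt_eq_pow (p := p) (le_max_right k l)
    refine ⟨max k l, r * n + s * m, ?_⟩
    rw [hr, hs, zpow_add, zpow_mul, zpow_mul, zpow_natCast, zpow_natCast]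
  | inv a _ ha =>
    obtain ⟨k, n, rfl⟩ := ha
    exact ⟨k, -n, by simp⟩

theorem commute_of_mem_ySubgroup {a b : G p} (ha : a ∈ ySubgroup p) (hb : b ∈ ySubgroup p) :
    Commute a b := by
  refine commute_of_mem_closure ?_ ha hb
  have key {k l : ℤ} (h : k ≤ l) : Commute (yt p k) (yt p l) := by
    obtain ⟨n, hn⟩ := exists_yt_eq_pow (p := p) h
    rw [hn]; exact Commute.pow_self _ n
  rintro _ ⟨k, rfl⟩ _ ⟨l, rfl⟩
  exact (le_total k l).elim key fun h => (key h).symm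

theorem cj_t_mem_ySubgroup {a : G p} (ha : a ∈ ySubgroup p) (l : ℤ) :
    cj a (gen p .t ^ l) ∈ ySubgroup p := by
  refine cj_mem_of_mem_closure ?_ ha
  rintro _ ⟨k, rfl⟩
  rw [cj_yt]; exact yt_mem _

/-- Every element of Y has the form (y^j)^(t^i), so the relators and x^u = x [x, u] settle k = 0;
conjugating by t^k gives the rest. -/
theorem commute_xt_cj_xt_self (k : ℤ) {h : G p} (hh : h ∈ ySubgroup p) :
    Commute (xt p k) (cj (xt p k) h) := by
  have hx {u : G p} (hu : u ∈ ySubgroup p) : Commute (gen p .x) (cj (gen p .x) u) := by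
    obtain ⟨i, j, rfl⟩ := exists_eq_yt_zpow hu
    have h1 := commute_comm_gen_x (p := p) i j
    rw [cj_zpow, ← yt, comm_eq_inv_mul_cj] at h1
    have h2 := (Commute.refl (gen p .x)).mul_left h1
    rw [mul_inv_cancel_left] at h2
    exact h2.symm
  have h1 := commute_cj (hx (cj_t_mem_ySubgroup hh (-k))) (gen p .t ^ k)
  rw [cj_cj] at h1
  have h2 : cj h (gen p .t ^ (-k)) * gen p .t ^ k = gen p .t ^ k * h := by
    rw [cj]; group
  rwa [h2, ← cj_cj] at h1

/-- Both x_k and x_l are powers of the one with smaller index. -/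
theorem commute_xt_cj_xt (k l : ℤ) {h : G p} (hh : h ∈ ySubgroup p) :
    Commute (xt p k) (cj (xt p l) h) := by
  obtain ⟨r, hr⟩ := exists_xt_eq_pow (p := p) (min_le_left k l)
  obtain ⟨s, hs⟩ := exists_xt_eq_pow (p := p) (min_le_right k l)
  rw [hr, hs, cj_pow]
  exact (commute_xt_cj_xt_self _ hh).pow_pow r s

variable (p) in
/-- The subgroup generated by the conjugates of `x`. -/
def xSubgroup : Subgroup (G p) :=
  Subgroup.closure {a | ∃ k : ℤ, ∃ h ∈ ySubgroup p, a = cj (xt p k) h}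

theorem cj_xt_mem (k : ℤ) {h : G p} (hh : h ∈ ySubgroup p) : cj (xt p k) h ∈ xSubgroup p :=
  Subgroup.subset_closure ⟨k, h, hh, rfl⟩

theorem gen_x_mem : gen p .x ∈ xSubgroup p := by
  have := cj_xt_mem (p := p) 0 (one_mem _)
  rwa [cj_one, xt_zero] at this

theorem gen_y_mem : gen p .y ∈ ySubgroup p := yt_zero (p := p) ▸ yt_mem 0

theorem commute_of_mem_xSubgroup {a b : G p} (ha : a ∈ xSubgroup p) (hb : b ∈ xSubgroup p) :
    Commute a b := by
  refine commute_of_mem_closure ?_ ha hb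
  rintro _ ⟨k, h, hh, rfl⟩ _ ⟨l, u, hu, rfl⟩
  have h1 := commute_cj (commute_xt_cj_xt k l (mul_mem hu (inv_mem hh))) h
  rwa [cj_cj, inv_mul_cancel_right] at h1

theorem cj_t_mem_xSubgroup {a : G p} (ha : a ∈ xSubgroup p) (l : ℤ) :
    cj a (gen p .t ^ l) ∈ xSubgroup p := by
  refine cj_mem_of_mem_closure ?_ ha
  rintro _ ⟨k, h, hh, rfl⟩
  have : cj (cj (xt p k) h) (gen p .t ^ l) = cj (xt p (k + l)) (cj h (gen p .t ^ l)) := by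
    simp only [← cj_xt, cj_cj]; congr 1; simp [cj, mul_assoc]
  rw [this]
  exact cj_xt_mem _ (cj_t_mem_ySubgroup hh l)

theorem cj_y_mem_xSubgroup {a u : G p} (ha : a ∈ xSubgroup p) (hu : u ∈ ySubgroup p) :
    cj a u ∈ xSubgroup p := by
  refine cj_mem_of_mem_closure ?_ ha
  rintro _ ⟨k, h, hh, rfl⟩
  rw [cj_cj]
  exact cj_xt_mem _ (mul_mem hh hu)

theorem cj_mem {H : Type*} [Group H] {K : Subgroup H} {a g : H} (ha : a ∈ K) (hg : g ∈ K) :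
    cj a g ∈ K := mul_mem (mul_mem (inv_mem hg) ha) hg

instance xSubgroup_normal : (xSubgroup p).Normal := by
  refine normal_of_cj_gen_mem ?_ ?_
  · rintro (_ | _ | _) a ha
    · exact cj_mem ha gen_x_mem
    · exact cj_y_mem_xSubgroup ha gen_y_mem
    · simpa using cj_t_mem_xSubgroup ha 1
  · rintro (_ | _ | _) a ha
    · exact cj_mem ha (inv_mem gen_x_mem)
    · exact cj_y_mem_xSubgroup ha (inv_mem gen_y_mem)
    · simpa using cj_t_mem_xSubgroup ha (-1)

variable (p) in
/-- The normal closure of `x` and `y`. -/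
def xySubgroup : Subgroup (G p) := ySubgroup p ⊔ xSubgroup p

theorem mem_xySubgroup {a : G p} :
    a ∈ xySubgroup p ↔ ∃ h ∈ ySubgroup p, ∃ m ∈ xSubgroup p, h * m = a :=
  Subgroup.mem_sup_of_normal_right

theorem cj_t_mem_xySubgroup {a : G p} (ha : a ∈ xySubgroup p) (l : ℤ) :
    cj a (gen p .t ^ l) ∈ xySubgroup p := by
  obtain ⟨h, hh, m, hm, rfl⟩ := mem_xySubgroup.1 ha
  rw [cj_mul]
  exact mul_mem (Subgroup.mem_sup_left (cj_t_mem_ySubgroup hh l))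
    (Subgroup.mem_sup_right (cj_t_mem_xSubgroup hm l))

instance xySubgroup_normal : (xySubgroup p).Normal := by
  have hx : gen p .x ∈ xySubgroup p := Subgroup.mem_sup_right gen_x_mem
  have hy : gen p .y ∈ xySubgroup p := Subgroup.mem_sup_left gen_y_mem
  refine normal_of_cj_gen_mem ?_ ?_
  · rintro (_ | _ | _) a ha
    · exact cj_mem ha hx
    · exact cj_mem ha hy
    · simpa using cj_t_mem_xySubgroup ha 1
  · rintro (_ | _ | _) a ha
    · exact cj_mem ha (inv_mem hx)
    · exact cj_mem ha (inv_mem hy)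
    · simpa using cj_t_mem_xySubgroup ha (-1)

/-! ### The derived series. -/

theorem commutator_le_xySubgroup : ⁅(⊤ : Subgroup (G p)), ⊤⁆ ≤ xySubgroup p := by
  let q := QuotientGroup.mk' (xySubgroup p)
  have hq (g : G p) : q g ∈ Subgroup.zpowers (q (gen p .t)) := by
    have hg : g ∈ Subgroup.closure (Set.range (gen p)) := by simp [closure_range_gen]
    have hle : Subgroup.closure (Set.range (gen p)) ≤
        (Subgroup.zpowers (q (gen p .t))).comap q := by
      rw [Subgroup.closure_le]
      rintro _ ⟨_ | _ | _, rfl⟩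
      · have : q (gen p .x) = 1 :=
          (QuotientGroup.eq_one_iff _).2 (Subgroup.mem_sup_right gen_x_mem)
        simp [this, one_mem]
      · have : q (gen p .y) = 1 :=
          (QuotientGroup.eq_one_iff _).2 (Subgroup.mem_sup_left gen_y_mem)
        simp [this, one_mem]
      · exact Subgroup.mem_zpowers _
    exact hle hg
  rw [Subgroup.commutator_le]
  intro a _ b _
  rw [← QuotientGroup.eq_one_iff]
  change q ⁅a, b⁆ = 1
  rw [map_commutatorElement, commutatorElement_eq_one_iff_commute]
  obtain ⟨m, hm⟩ := hq a
  obtain ⟨n, hn⟩ := hq b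
  rw [← hm, ← hn]
  exact Commute.zpow_zpow_self _ m n

theorem commutator_xySubgroup_le : ⁅xySubgroup p, xySubgroup p⁆ ≤ xSubgroup p := by
  let q := QuotientGroup.mk' (xSubgroup p)
  have hq {m : G p} (hm : m ∈ xSubgroup p) : q m = 1 := (QuotientGroup.eq_one_iff _).2 hm
  rw [Subgroup.commutator_le]
  intro a ha b hb
  obtain ⟨h, hh, m, hm, rfl⟩ := mem_xySubgroup.1 ha
  obtain ⟨u, hu, n, hn, rfl⟩ := mem_xySubgroup.1 hb
  rw [← QuotientGroup.eq_one_iff]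
  change q ⁅h * m, u * n⁆ = 1
  rw [map_commutatorElement, map_mul, map_mul, hq hm, hq hn, mul_one, mul_one,
    commutatorElement_eq_one_iff_commute]
  exact (commute_of_mem_ySubgroup hh hu).map q

theorem derivedSeries_one_le : derivedSeries (G p) 1 ≤ xySubgroup p := commutator_le_xySubgroup

theorem derivedSeries_two_le : derivedSeries (G p) 2 ≤ xSubgroup p :=
  (Subgroup.commutator_mono derivedSeries_one_le derivedSeries_one_le).trans
    commutator_xySubgroup_le

theorem derivedSeries_three : derivedSeries (G p) 3 = ⊥ := by
  rw [eq_bot_iff]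
  refine (Subgroup.commutator_mono derivedSeries_two_le derivedSeries_two_le).trans ?_
  rw [Subgroup.commutator_le]
  intro a ha b hb
  rw [Subgroup.mem_bot, commutatorElement_eq_one_iff_commute]
  exact commute_of_mem_xSubgroup ha hb

theorem comm_mem_derivedSeries_succ {H : Type*} [Group H] {n : ℕ} {a b : H}
    (ha : a ∈ derivedSeries H n) (hb : b ∈ derivedSeries H n) :
    comm a b ∈ derivedSeries H (n + 1) := by
  rw [comm_eq_commutatorElement]
  exact Subgroup.commutator_mem_commutator (inv_mem ha) (inv_mem hb)

/-! ### The iterated identity. -/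

theorem exists_commute_pow {a g : G p} (ha : a ∈ xSubgroup p) (hg : g ∈ xySubgroup p) :
    ∃ m : ℕ, Commute (a ^ p ^ m) g := by
  obtain ⟨u, hu, b, hb, rfl⟩ := mem_xySubgroup.1 hg
  suffices h : ∃ m : ℕ, Commute (a ^ p ^ m) u by
    obtain ⟨m, hm⟩ := h
    exact ⟨m, hm.mul_right (commute_of_mem_xSubgroup (pow_mem ha _) hb)⟩
  clear hg
  induction ha using Subgroup.closure_induction with
  | mem a ha =>
    obtain ⟨k, h, hh, rfl⟩ := ha
    obtain ⟨l, n, rfl⟩ := exists_eq_yt_zpow hu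
    -- Raising to p^m turns x_k into x_{k+m}, which commutes with y_l once k + m ≥ l.
    refine ⟨(l - k).toNat, ?_⟩
    rw [← cj_pow, ← xt_add_nat]
    have h1 : Commute (xt p (k + (l - k).toNat)) (yt p l ^ n) :=
      (commute_xt_yt (by omega)).zpow_right n
    have h2 := commute_cj h1 h
    rwa [cj_eq_of_commute (commute_of_mem_ySubgroup hu hh)] at h2
  | one => exact ⟨0, by simp⟩
  | mul a b ha hb h1 h2 =>
    obtain ⟨m, hm⟩ := h1
    obtain ⟨n, hn⟩ := h2
    refine ⟨m + n, ?_⟩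
    rw [(commute_of_mem_xSubgroup ha hb).mul_pow]
    refine Commute.mul_left ?_ ?_
    · rw [pow_add, pow_mul]; exact hm.pow_left _
    · rw [pow_add, mul_comm, pow_mul]; exact hn.pow_left _
  | inv a _ h1 =>
    obtain ⟨m, hm⟩ := h1
    exact ⟨m, by rw [inv_pow]; exact hm.inv_left⟩

/-- By [a, g]^p = [a^p, g] on X, the p^m-th power of the next iterate is [a^(p^(m+1)), g] = 1, so
the hypothesis passes from m + 1 to m. -/
theorem exists_iter_eq_one (v : Fin 3 → G p) (m : ℕ) : ∀ j : ℕ, iter (w p) v j ∈ xSubgroup p →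
    Commute (iter (w p) v j ^ p ^ m) (comm (v 1) (v 2)) → ∃ k : ℕ, iter (w p) v k = 1 := by
  set g := comm (v 1) (v 2) with hg
  induction m with
  | zero =>
    intro j _ h
    refine ⟨j + 1, ?_⟩
    rw [pow_zero, pow_one] at h
    rw [iter_w_succ, comm_eq_one_iff.2 h, one_pow]
  | succ m ih =>
    intro j hj h
    have hc : cj (iter (w p) v j) g ∈ xSubgroup p := by
      simpa [cj] using (xSubgroup_normal (p := p)).conj_mem _ hj g⁻¹
    have h1 : iter (w p) v (j + 1) ^ p ^ m = 1 := by
      rw [iter_w_succ, ← pow_mul, ← pow_succ', comm_pow_left (commute_of_mem_xSubgroup hj hc)]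
      exact comm_eq_one_iff.2 h
    refine ih (j + 1) ?_ (by rw [h1]; exact Commute.one_left _)
    rw [iter_w_succ, comm_eq_inv_mul_cj]
    exact pow_mem (mul_mem (inv_mem hj) hc) _

theorem isIteratedIdentity_w (p : ℕ) : IsIteratedIdentity (G p) (w p) := by
  intro v
  have top (a : G p) : a ∈ derivedSeries (G p) 0 := Subgroup.mem_top a
  have hg := comm_mem_derivedSeries_succ (top (v 1)) (top (v 2))
  have h0 : iter (w p) v 0 ∈ derivedSeries (G p) 1 := by
    rw [iter_w_zero]; exact pow_mem (comm_mem_derivedSeries_succ (top _) (top _)) _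
  -- The zeroth iterate is only known to lie in G'; one more commutator with g ∈ G' brings it into
  -- G'' ≤ X.
  have h1 : iter (w p) v 1 ∈ xSubgroup p := by
    rw [iter_w_succ]
    exact derivedSeries_two_le (pow_mem (comm_mem_derivedSeries_succ h0 hg) _)
  obtain ⟨m, hm⟩ := exists_commute_pow h1 (derivedSeries_one_le hg)
  exact exists_iter_eq_one v m 1 h1 hm

/-! ### Exact derived length, finite generation and unboundedness. -/

theorem derivedSeries_two_ne_bot (hp : 1 < p) : derivedSeries (G p) 2 ≠ ⊥ := by
  intro h
  have top (a : G p) : a ∈ derivedSeries (G p) 0 := Subgroup.mem_top a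
  let t := gen p .t
  let a := comm (xt p (-1)) t
  let b := comm t⁻¹ (yt p 1)⁻¹
  have hab : comm a b = 1 := by
    have := comm_mem_derivedSeries_succ (comm_mem_derivedSeries_succ (top (xt p (-1))) (top t))
      (comm_mem_derivedSeries_succ (top t⁻¹) (top (yt p 1)⁻¹))
    rwa [h, Subgroup.mem_bot] at this
  have hp' : (p : ℚ) ≠ 0 := by exact_mod_cast (by omega : p ≠ 0)
  set u : ℚˣ := Units.mk0 p hp' with hu
  have hup : (u : ℚ) = p := rfl
  have ea : toModel u hup a = fiberShift (bump p 1 - bump p (p : ℚ)⁻¹) := by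
    simp only [a, t, xt, comm_eq_inv_mul_cj, map_mul, map_inv, map_cj, map_zpow, toModel_gen,
      modelGen, cj_bump_dilation_zpow u hup, cj_bump_dilation u hup, fiberShift_inv,
      fiberShift_mul]
    rw [neg_add_eq_sub]
    simp [hu, hp']
  have eb : toModel u hup b = baseShift (1 - (p : ℚ)⁻¹) := by
    simp only [b, t, yt, map_comm, map_inv, map_cj, map_zpow, toModel_gen, modelGen,
      cj_baseShift_dilation_zpow, baseShift_inv, comm_dilation_baseShift]
    congr 1
    simp [hu, sub_mul, hp']
  have h1 := congrArg (toModel u hup) hab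
  rw [map_comm, ea, eb, map_one, comm_fiberShift_baseShift] at h1
  -- At level 0 the support is ℤ, which contains 0 but not -(1 - 1/p); the difference there is -1/p,
  -- nonzero modulo 1.
  have h2 := eq_zero_of_fiberShift_eq_one h1 0 (-(1 - (p : ℚ)⁻¹))
  have hz (r : ℚ) : bump p r 0 (-(1 - (p : ℚ)⁻¹)) = 0 := by
    have := bump_eq_zero_of_step hp r 1 1 1 one_pos le_rfl
    rw [← this]
    congr 1
    simp [sub_mul, hp']
  have h3 : bump p 1 0 0 = 0 := by
    rw [bump_zero, AddCircle.coe_eq_zero_iff]; exact ⟨1, by simp⟩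
  simp only [Pi.sub_apply, neg_add_cancel, hz, sub_zero, h3, zero_sub, neg_eq_zero,
    bump_zero, zpow_zero, mul_one] at h2
  exact coe_zpow_neg_ne_zero hp (k := -1) (by norm_num) (by rwa [zpow_neg_one])

theorem group_fg (p : ℕ) : Group.FG (G p) := by
  have : Finite Gen := Finite.of_surjective (![Gen.x, Gen.y, Gen.t] : Fin 3 → Gen) (by
    rintro (_ | _ | _)
    exacts [⟨0, rfl⟩, ⟨1, rfl⟩, ⟨2, rfl⟩])
  exact Group.fg_iff.2 ⟨_, closure_range_gen p, Set.finite_range _⟩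

theorem not_isBoundedOn_w (hp : 1 < p) : ¬ IsBoundedOn (G p) (w p) := by
  rintro ⟨j, hj⟩
  exact iter_triple_ne_one hp (Nat.lt_succ_self (j + 1)) (hj (triple p (j + 2)))

end Structure

end IterId

theorem theorem1 (p : ℕ) (hp : p.Prime) :
    Group.FG (IterId.G p) ∧
    Group.IsSolvable (IterId.G p) ∧
    IterId.HasDerivedLength (IterId.G p) 3 ∧
    IterId.IsIteratedIdentity (IterId.G p) (IterId.w p) ∧
    ¬ IterId.IsBoundedOn (IterId.G p) (IterId.w p) ∧
    IterId.IsFractalGroup (IterId.G p) ∧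
    (∀ i j : ℕ, j + 1 < i → IterId.iter (IterId.w p) (IterId.triple p i) j ≠ 1) := by
  have h1 := IterId.isIteratedIdentity_w p
  have h2 := IterId.not_isBoundedOn_w hp.one_lt
  refine ⟨IterId.group_fg p, ⟨3, IterId.derivedSeries_three⟩,
    ⟨IterId.derivedSeries_three, fun m hm h => ?_⟩, h1, h2, ⟨⟨2, _, h1⟩, fun h => h2 (h 2 _ h1)⟩,
    fun i j hij => IterId.iter_triple_ne_one hp.one_lt hij⟩
  refine IterId.derivedSeries_two_ne_bot hp.one_lt (eq_bot_iff.2 ?_)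
  rw [← h]
  exact derivedSeries_antitone _ (by omega)
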